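/- Definitions. For a metric space $(M,d)$, $x\in M$ and $A\subseteq M$ put $D(x,A)=\sup\{d(x,a):a\in A\}$, and let $\delta(A)$ be the diameter of $A$. For $T:M\to M$ let $o_T(y)=\{y\}\cup\{T^ny:n\in\mathbb N\}$; $T$ is orbit-nonexpansive if $d(Tx,Ty)\le D(x,o_T(y))$ for all $x,y\in M$. A set $E\subseteq M$ is a one-local retract of $M$ if for every family of closed balls of $M$ centred at points of $E$ with nonempty intersection, this intersection meets $E$. If $\tau$ is the weak topology of a Banach space $X$ (respectively the weak$^*$ topology of a dual space $X$), then $X$ has weak (respectively weak$^*$) normal structure if every convex bounded $\tau$-compact set $K\subseteq X$ with more than one point contains a point $z$ with $D(z,K)<\delta(K)$. Statement. Let $M$ be a nonempty convex closed bounded subset of a (real or complex) Banach space $X$ satisfying one of the following conditions: (i) $X$ has weak normal structure and $M$ is weakly compact; (ii) $X$ is (isometrically) a dual space with weak$^*$ normal structure and $M$ is weak$^*$ compact; (iii) $X$ is (isometrically) $L_1[0,1]$ and $M$ is compact in the topology of convergence in measure. Then every family $(T_i)_{i\in I}$ of pairwise commuting orbit-nonexpansive maps $T_i:M\to M$ has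 a common fixed point, and the set $\{x\in M: T_ix=x \text{ for all } i\in I\}$ of its common fixed points is a one-local retract of $M$. Furthermore, if a group $\mathcal S$ acts on $M$ (the unit acting as the identity) and each $s\in\mathcal S$ acts as an orbit-nonexpansive map, then there is $x\in M$ such that $s(x)=x$ for all $s\in\mathcal S$. -/

import Mathlib

open Set MeasureTheory Filter
open scoped ENNReal

noncomputable section

/-- The orbit `o_T(x) = {x} ∪ {T^n x : n ∈ ℕ}`. -/
def orbitOf {α : Type*} (T : α → α) (x : α) : Set α :=
  {x} ∪ {y | ∃ n : ℕ, y = T^[n] x}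

/-- `D(x, A) = sup {d(x, a) : a ∈ A}`, the least radius of a closed ball about `x` containing `A`,
with values in `[0, ∞]` (finite when `A` is bounded). -/
def outerRadius {α : Type*} [MetricSpace α] (x : α) (A : Set α) : ℝ≥0∞ :=
  ⨆ a ∈ A, edist x a

/-- `T` is orbit-nonexpansive: `d(Tx, Ty) ≤ D(x, o_T(y))` for all `x`, `y`. -/
def OrbitNonexpansive {α : Type*} [MetricSpace α] (T : α → α) : Prop :=
  ∀ x y : α, edist (T x) (T y) ≤ outerRadius x (orbitOf T y)

/-- `D` is a one-local retract of `α`: every family of closed balls of `α` centred at points of `D`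
(given as a set of pairs (centre, radius)) with nonempty intersection has an intersection that
meets `D`. -/
def IsOneLocalRetract {α : Type*} [MetricSpace α] (D : Set α) : Prop :=
  ∀ B : Set (α × ℝ), (∀ p ∈ B, p.1 ∈ D) →
    (⋂ p ∈ B, Metric.closedBall p.1 p.2).Nonempty →
    ((⋂ p ∈ B, Metric.closedBall p.1 p.2) ∩ D).Nonempty

/-- Normal structure of a normed space with respect to a topology `τ`: every convex bounded
`τ`-compact set `K` with more than one point has a point `z ∈ K` with `D(z, K) < diam K`. -/
def HasNormalStructure (X : Type*) [NormedAddCommGroup X] [NormedSpace ℝ X]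
    (τ : TopologicalSpace X) : Prop :=
  ∀ K : Set X, Convex ℝ K → Bornology.IsBounded K → @IsCompact X τ K → K.Nontrivial →
    ∃ z ∈ K, outerRadius z K < Metric.ediam K

/-- The weak topology `σ(X, X*)`, as a topology on `X` itself. -/
@[reducible] def weakTopology (𝕜 X : Type*) [RCLike 𝕜] [NormedAddCommGroup X] [NormedSpace 𝕜 X] :
    TopologicalSpace X :=
  (inferInstance : TopologicalSpace (WeakSpace 𝕜 X)).induced (toWeakSpace 𝕜 X)

/-- The weak* topology on `X` when `X` is identified with the dual of `Y` by the isometry `e`. -/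
@[reducible] def weakStarTopology {𝕜 X Y : Type*} [RCLike 𝕜] [NormedAddCommGroup X] [NormedSpace 𝕜 X]
    [NormedAddCommGroup Y] [NormedSpace 𝕜 Y] (e : X ≃ₗᵢ[𝕜] StrongDual 𝕜 Y) :
    TopologicalSpace X :=
  (inferInstance : TopologicalSpace (WeakDual 𝕜 Y)).induced
    (fun x => StrongDual.toWeakDual (e x))

/-- The space `L₁[0,1]` of (classes of) `𝕜`-valued functions, with Lebesgue measure. -/
abbrev L1Unit (𝕜 : Type*) [RCLike 𝕜] : Type _ :=
  Lp 𝕜 1 (volume.restrict (Icc (0 : ℝ) 1))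

/-- The set of pairs `(f, g)` with `μ {|f - g| ≥ ε} ≤ ε`. -/
def measureEntourage (𝕜 : Type*) [RCLike 𝕜] (ε : ℝ≥0∞) : Set (L1Unit 𝕜 × L1Unit 𝕜) :=
  {p | volume.restrict (Icc (0 : ℝ) 1) {t | ε ≤ edist (p.1 t) (p.2 t)} ≤ ε}

/-- The uniformity of convergence in measure on `L₁[0,1]`, generated by the sets
`{(f, g) : μ {|f - g| ≥ ε} ≤ ε}`, `ε > 0`. -/
@[reducible] def measureUniformity (𝕜 : Type*) [RCLike 𝕜] : UniformSpace (L1Unit 𝕜) :=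
  .ofCore
  { uniformity := ⨅ ε ∈ Ioi (0 : ℝ≥0∞), 𝓟 (measureEntourage 𝕜 ε)
    refl := by
      refine le_iInf₂ fun ε hε => ?_
      rw [principal_mono, SetRel.id_subset_iff]
      refine ⟨fun f => ?_⟩
      have hε' : ¬ ε ≤ 0 := not_le.mpr hε
      simp [measureEntourage, hε']
    symm := by
      refine tendsto_iInf.2 fun ε => tendsto_iInf.2 fun hε => tendsto_iInf' ε <|
        tendsto_iInf' hε <| tendsto_principal_principal.2 fun p hp => ?_
      simpa [measureEntourage, edist_comm] using hp
    comp := by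
      refine le_iInf₂ fun ε hε => ?_
      have hε2 : ε / 2 ∈ Ioi (0 : ℝ≥0∞) := ENNReal.half_pos (ne_of_gt hε)
      refine (lift'_le (s := measureEntourage 𝕜 (ε / 2)) ?_ ?_)
      · exact mem_iInf_of_mem _ (mem_iInf_of_mem hε2 (mem_principal_self _))
      · rw [principal_mono]
        rintro ⟨f, g⟩ ⟨h, hfh, hhg⟩
        simp only [measureEntourage, mem_ofPred_eq] at hfh hhg ⊢
        refine (measure_mono ?_).trans ((measure_union_le
          {t | ε / 2 ≤ edist (f t) (h t)} {t | ε / 2 ≤ edist (h t) (g t)}).trans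
            ((add_le_add hfh hhg).trans (ENNReal.add_halves ε).le))
        intro t ht
        by_contra hc
        simp only [mem_union, mem_ofPred_eq, not_or, not_le] at hc ht
        exact absurd (ht.trans (edist_triangle _ (h t) _)) (not_le.mpr
          ((ENNReal.add_lt_add hc.1 hc.2).trans_eq (ENNReal.add_halves ε))) }

/-- The topology of convergence in measure on `X` when `X` is identified with `L₁[0,1]` by the
isometry `e`. -/
@[reducible] def inMeasureTopology {𝕜 X : Type*} [RCLike 𝕜] [NormedAddCommGroup X] [NormedSpace 𝕜 X]
    (e : X ≃ₗᵢ[𝕜] L1Unit 𝕜) : TopologicalSpace X :=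
  (measureUniformity 𝕜).toTopologicalSpace.induced e

end

/-!
The theorem is a metric fact about closed balls: it holds in every metric space whose closed balls
are compact (`BallCompact`: the finite intersection property) and normal (`BallNormal`: an
intersection of closed balls with more than one point has a point from which it is seen within a
radius smaller than its diameter).

For a single map, or a group of maps, a minimal invariant intersection of balls `E` cannot have more
than one point: normality yields a proper subset of `E` consisting of the points that see `E` within
radius `r`, and orbit-nonexpansiveness makes it invariant, because the orbits of points of `E` stay
in `E` (`exists_forall_eq_of_minimal`). Everything works relative to a one-local retract `N`, since
compactness and normality of the balls pass to `N` (`sInter_nonempty_of_isChain`,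
`IsAdmissibleIn.exists_normal_point`). Hence the common fixed points of a set of commuting maps stay
a nonempty one-local retract when one more map is added
(`OrbitNonexpansive.fixedPoints_inter`), and Baillon's theorem
(`sInter_of_isChain_isOneLocalRetract`) deals with unions of chains of sets of maps; Zorn's lemma
then gives the whole family.

In each of the three cases the closed balls of `M` inherit compactness and normality from a topology
on `X` in which closed balls are closed and which has normal structure. For convergence in measure
on `L₁[0,1]` both properties follow from one inequality of Brezis–Lieb type
(`exists_measureEntourage_edist_add_le`): if `u` is close to `x` in measure, then `‖u - y‖` is at
least about `‖u - x‖ + ‖x - y‖`. If all points of a compact convex `K` were diametral, choosing `y`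
almost at distance `diam K` from `x` would force `‖u - x‖` to be small, so `K` would be totally
bounded in norm, and the average of a finite net would not be diametral.
-/

/-! ### Admissible subsets of a one-local retract -/

/-- `D` is admissible in `N`: it is the trace on `N` of an intersection of closed balls centred at
points of `N`. This is expressed intrinsically: `D ⊆ N`, and a point of `N` lying in every closed
ball that is centred in `N` and contains `D` belongs to `D`. -/
def IsAdmissibleIn {α : Type*} [MetricSpace α] (N D : Set α) : Prop :=
  D ⊆ N ∧ ∀ y ∈ N, (∀ x ∈ N, ∀ r, D ⊆ Metric.closedBall x r → y ∈ Metric.closedBall x r) → y ∈ D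

/-- Compactness of the closed balls: a family of closed balls (given as a set of pairs of a centre
and a radius) with the finite intersection property has a common point. -/
def BallCompact (α : Type*) [MetricSpace α] : Prop :=
  ∀ B : Set (α × ℝ),
    (∀ F : Finset (α × ℝ), (F : Set (α × ℝ)) ⊆ B →
      (⋂ p ∈ F, Metric.closedBall p.1 p.2).Nonempty) →
    (⋂ p ∈ B, Metric.closedBall p.1 p.2).Nonempty

/-- Normality of the intersections of closed balls: each one with more than one point lies in a
closed ball centred at one of its points, of radius `r` smaller than its diameter. The latter is
stated through a pair of points at distance more than `r`. -/
def BallNormal (α : Type*) [MetricSpace α] : Prop :=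
  ∀ B : Set (α × ℝ), (⋂ p ∈ B, Metric.closedBall p.1 p.2).Nontrivial →
    ∃ z ∈ ⋂ p ∈ B, Metric.closedBall p.1 p.2, ∃ r,
      (⋂ p ∈ B, Metric.closedBall p.1 p.2) ⊆ Metric.closedBall z r ∧
      ∃ a ∈ ⋂ p ∈ B, Metric.closedBall p.1 p.2, ∃ b ∈ ⋂ p ∈ B, Metric.closedBall p.1 p.2,
        r < dist a b

section Admissible

variable {α : Type*} [MetricSpace α] {N D : Set α}

theorem IsAdmissibleIn.self (N : Set α) : IsAdmissibleIn N N :=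
  ⟨Subset.rfl, fun _ hy _ => hy⟩

theorem IsAdmissibleIn.inter_closedBall (hD : IsAdmissibleIn N D) {c : α} (hc : c ∈ N) (r : ℝ) :
    IsAdmissibleIn N (D ∩ Metric.closedBall c r) :=
  ⟨inter_subset_left.trans hD.1, fun y hy h =>
    ⟨hD.2 y hy fun x hx s hs => h x hx s (inter_subset_left.trans hs),
      h c hc r inter_subset_right⟩⟩

theorem IsAdmissibleIn.sInter {𝒟 : Set (Set α)} (hne : 𝒟.Nonempty)
    (h : ∀ D ∈ 𝒟, IsAdmissibleIn N D) : IsAdmissibleIn N (⋂₀ 𝒟) := by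
  obtain ⟨D₀, hD₀⟩ := hne
  refine ⟨(sInter_subset_of_mem hD₀).trans (h D₀ hD₀).1, fun y hy hb D hD => ?_⟩
  exact (h D hD).2 y hy fun x hx r hr => hb x hx r ((sInter_subset_of_mem hD).trans hr)

theorem isAdmissibleIn_inter_biInter {B : Set (α × ℝ)} (hB : ∀ p ∈ B, p.1 ∈ N) :
    IsAdmissibleIn N (N ∩ ⋂ p ∈ B, Metric.closedBall p.1 p.2) :=
  ⟨inter_subset_left, fun _ hy h => ⟨hy, mem_iInter₂.2 fun p hp =>
    h p.1 (hB p hp) p.2 (inter_subset_right.trans (biInter_subset_of_mem hp))⟩⟩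

/-- The points of `D` from which `D` is seen within distance `r` form an admissible set. -/
theorem IsAdmissibleIn.centers (hD : IsAdmissibleIn N D) (r : ℝ) :
    IsAdmissibleIn N {x ∈ D | D ⊆ Metric.closedBall x r} := by
  refine ⟨fun x hx => hD.1 hx.1, fun y hy h => ⟨?_, fun a ha => ?_⟩⟩
  · exact hD.2 y hy fun x hx s hs => h x hx s fun w hw => hs hw.1
  · rw [Metric.mem_closedBall_comm]
    exact h a (hD.1 ha) r fun w hw => Metric.mem_closedBall_comm.1 (hw.2 ha)

/-- A point of the ambient space that satisfies all the ball constraints of `D`, and sees `D` within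
distance `r`, can be replaced by a point of `D`. -/
theorem IsAdmissibleIn.exists_center (hN : IsOneLocalRetract N) (hD : IsAdmissibleIn N D) {z : α}
    {r : ℝ} (hz : ∀ x ∈ N, ∀ s, D ⊆ Metric.closedBall x s → z ∈ Metric.closedBall x s)
    (hr : D ⊆ Metric.closedBall z r) : ∃ z' ∈ D, D ⊆ Metric.closedBall z' r := by
  obtain ⟨y, hy, hyN⟩ := hN
    ({p | p.1 ∈ N ∧ D ⊆ Metric.closedBall p.1 p.2} ∪ {p | p.1 ∈ D ∧ p.2 = r})
    (by
      rintro p (hp | hp)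
      exacts [hp.1, hD.1 hp.1])
    ⟨z, by
      refine mem_iInter₂.2 ?_
      rintro ⟨x, s⟩ (hp | ⟨hx, rfl⟩)
      · exact hz x hp.1 s hp.2
      · exact Metric.mem_closedBall_comm.1 (hr hx)⟩
  rw [mem_iInter₂] at hy
  refine ⟨y, hD.2 y hyN fun x hx s hs => hy (x, s) (Or.inl ⟨hx, hs⟩), fun a ha => ?_⟩
  exact Metric.mem_closedBall_comm.1 (hy (a, r) (Or.inr ⟨ha, rfl⟩))

/-- Compactness passes from the ambient space to its one-local retracts. -/
theorem sInter_nonempty_of_isChain (hα : BallCompact α) (hN : IsOneLocalRetract N)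
    {𝒟 : Set (Set α)} (hne : 𝒟.Nonempty) (hch : IsChain (· ⊆ ·) 𝒟)
    (h𝒟 : ∀ D ∈ 𝒟, D.Nonempty ∧ IsAdmissibleIn N D) : (⋂₀ 𝒟).Nonempty := by
  classical
  let B : Set (α × ℝ) := {p | p.1 ∈ N ∧ ∃ D ∈ 𝒟, D ⊆ Metric.closedBall p.1 p.2}
  have hfin : ∀ F : Finset (α × ℝ), (F : Set (α × ℝ)) ⊆ B →
      ∃ D ∈ 𝒟, ∀ p ∈ F, D ⊆ Metric.closedBall p.1 p.2 := by
    intro F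
    induction F using Finset.induction_on with
    | empty => exact fun _ => ⟨hne.some, hne.some_mem, by simp⟩
    | insert p F _ ih =>
      intro hF
      rw [Finset.coe_insert, insert_subset_iff] at hF
      obtain ⟨D₁, hD₁, h₁⟩ := ih hF.2
      obtain ⟨-, D₂, hD₂, h₂⟩ := hF.1
      rcases hch.total hD₁ hD₂ with h | h
      · refine ⟨D₁, hD₁, fun q hq => ?_⟩
        rcases Finset.mem_insert.1 hq with rfl | hq
        exacts [h.trans h₂, h₁ q hq]
      · refine ⟨D₂, hD₂, fun q hq => ?_⟩
        rcases Finset.mem_insert.1 hq with rfl | hq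
        exacts [h₂, h.trans (h₁ q hq)]
  obtain ⟨y, hy, hyN⟩ := hN B (fun p hp => hp.1) (hα B fun F hF => by
    obtain ⟨D, hD, h⟩ := hfin F hF
    obtain ⟨w, hw⟩ := (h𝒟 D hD).1
    exact ⟨w, mem_iInter₂.2 fun p hp => h p hp hw⟩)
  rw [mem_iInter₂] at hy
  exact ⟨y, fun D hD => (h𝒟 D hD).2.2 y hyN fun x hx r hr => hy (x, r) ⟨hx, D, hD, hr⟩⟩

/-- Normality passes from the ambient space to its one-local retracts: the intersection of all the
closed balls containing `D` has the same diameter as `D`. -/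
theorem IsAdmissibleIn.exists_normal_point (hα : BallNormal α) (hN : IsOneLocalRetract N)
    (hD : IsAdmissibleIn N D) (hnt : D.Nontrivial) :
    ∃ z ∈ D, ∃ r, D ⊆ Metric.closedBall z r ∧ ∃ a ∈ D, ∃ b ∈ D, r < dist a b := by
  let B : Set (α × ℝ) := {p | D ⊆ Metric.closedBall p.1 p.2}
  have hDB : D ⊆ ⋂ p ∈ B, Metric.closedBall p.1 p.2 := subset_iInter₂ fun p hp => hp
  obtain ⟨z, hz, r, hr, a, ha, b, hb, hab⟩ := hα B (hnt.mono hDB)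
  rw [mem_iInter₂] at hz ha hb
  obtain ⟨z', hz', h'⟩ := hD.exists_center hN (fun x _ s hs => hz (x, s) hs) (hDB.trans hr)
  refine ⟨z', hz', r, h', ?_⟩
  by_contra! hcon
  have h₁ : ∀ x ∈ D, D ⊆ Metric.closedBall x r := fun x hx y hy => hcon y hy x hx
  have h₂ : D ⊆ Metric.closedBall b r := fun x hx =>
    Metric.mem_closedBall_comm.1 (hb (x, r) (h₁ x hx))
  exact absurd (ha (b, r) h₂) (not_le.2 hab)

/-! ### Fixed points in invariant admissible sets -/

/-- The only consequence of orbit-nonexpansiveness that is needed: on a `T`-invariant set `E`, the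
image of `x` is as close to the image of `E` as `x` is to `E`. -/
theorem OrbitNonexpansive.dist_le {T : α → α} (hT : OrbitNonexpansive T) {E : Set α}
    (hE : MapsTo T E E) {x y : α} (hy : y ∈ E) {r : ℝ} (hr : E ⊆ Metric.closedBall x r) :
    dist (T x) (T y) ≤ r := by
  have hr0 : 0 ≤ r := dist_nonneg.trans (hr hy)
  rw [dist_edist]
  refine ENNReal.toReal_le_of_le_ofReal hr0 ((hT x y).trans (iSup₂_le fun a ha => ?_))
  have haE : a ∈ E := by
    rcases ha with rfl | ⟨n, rfl⟩
    exacts [hy, hE.iterate n hy]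
  rw [edist_dist]
  exact ENNReal.ofReal_le_ofReal (Metric.mem_closedBall'.1 (hr haE))

/-- Kirk's argument: a minimal invariant admissible set is a singleton, provided that closed balls
centred in it and containing the image of it under one of the maps contain the set itself. -/
theorem exists_forall_eq_of_minimal (hc : BallCompact α) (hn : BallNormal α)
    (hN : IsOneLocalRetract N) {ι : Type*} {T : ι → α → α} (hT : ∀ i, OrbitNonexpansive (T i))
    (hball : ∀ E, Minimal
      (· ∈ {E : Set α | E.Nonempty ∧ IsAdmissibleIn N E ∧ ∀ i, MapsTo (T i) E E}) E →
      ∀ i, ∀ c ∈ E, ∀ r, MapsTo (T i) E (Metric.closedBall c r) → E ⊆ Metric.closedBall c r)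
    (hne : D.Nonempty) (hD : IsAdmissibleIn N D) (hinv : ∀ i, MapsTo (T i) D D) :
    ∃ x ∈ D, ∀ i, T i x = x := by
  obtain ⟨E, hED, hE⟩ := zorn_superset_nonempty
    {E : Set α | E.Nonempty ∧ IsAdmissibleIn N E ∧ ∀ i, MapsTo (T i) E E}
    (fun c hcS hch hcne => ⟨⋂₀ c,
      ⟨sInter_nonempty_of_isChain hc hN hcne hch fun E hE => ⟨(hcS hE).1, (hcS hE).2.1⟩,
        IsAdmissibleIn.sInter hcne fun E hE => (hcS hE).2.1,
        fun i x hx E hE => (hcS hE).2.2 i (hx E hE)⟩,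
      fun s hs => sInter_subset_of_mem hs⟩) D ⟨hne, hD, hinv⟩
  obtain ⟨⟨x, hx⟩, hEadm, hEinv⟩ := hE.prop
  have hsub : E.Subsingleton := by
    by_contra hnt
    obtain ⟨z, hz, r, hr, a, ha, b, hb, hab⟩ :=
      hEadm.exists_normal_point hn hN (not_subsingleton_iff.1 hnt)
    have hC := hE.le_of_le
      (y := {x ∈ E | E ⊆ Metric.closedBall x r})
      ⟨⟨z, hz, hr⟩, hEadm.centers r, fun i x hx => ⟨hEinv i hx.1,
        hball E hE i _ (hEinv i hx.1) r fun y hy =>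
          Metric.mem_closedBall'.2 ((hT i).dist_le (hEinv i) hy hx.2)⟩⟩ (sep_subset _ _)
    exact absurd ((hC hb).2 ha) (not_le.2 hab)
  exact ⟨x, hED hx, fun i => hsub (hEinv i hx) hx⟩

theorem OrbitNonexpansive.exists_eq (hc : BallCompact α) (hn : BallNormal α)
    (hN : IsOneLocalRetract N) {T : α → α} (hT : OrbitNonexpansive T)
    (hne : D.Nonempty) (hD : IsAdmissibleIn N D) (hinv : MapsTo T D D) : ∃ x ∈ D, T x = x := by
  obtain ⟨x, hx, h⟩ := exists_forall_eq_of_minimal hc hn hN (T := fun _ : Unit => T)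
    (fun _ => hT) (fun E hE i c hcE r hm => by
      obtain ⟨⟨x, hx⟩, hEadm, hEinv⟩ := hE.prop
      have h := hE.le_of_le (y := E ∩ Metric.closedBall c r)
        ⟨⟨T x, hEinv i hx, hm hx⟩, hEadm.inter_closedBall (hEadm.1 hcE) r,
          fun i y hy => ⟨hEinv i hy.1, hm hy.1⟩⟩ inter_subset_left
      exact fun y hy => (h hy).2) hne hD (fun _ => hinv)
  exact ⟨x, hx, h ()⟩

/-- Adding one more map: if `T` leaves a one-local retract invariant, its fixed points there form a
nonempty one-local retract of the whole space. -/
theorem OrbitNonexpansive.fixedPoints_inter (hc : BallCompact α) (hn : BallNormal α)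
    (hNne : N.Nonempty) (hN : IsOneLocalRetract N) {T : α → α} (hT : OrbitNonexpansive T)
    (hinv : MapsTo T N N) :
    (N ∩ {x | T x = x}).Nonempty ∧ IsOneLocalRetract (N ∩ {x | T x = x}) := by
  refine ⟨hT.exists_eq hc hn hN hNne (.self N) hinv, fun B hB hne => ?_⟩
  obtain ⟨x, hx, hTx⟩ := hT.exists_eq hc hn hN (D := N ∩ ⋂ p ∈ B, Metric.closedBall p.1 p.2)
    ((hN B (fun p hp => (hB p hp).1) hne).mono fun x hx => ⟨hx.2, hx.1⟩)
    (isAdmissibleIn_inter_biInter fun p hp => (hB p hp).1)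
    (fun x hx => ⟨hinv hx.1, mem_iInter₂.2 fun p hp => by
      -- the orbit of the centre `p.1` is a single point
      have hfix : MapsTo T {p.1} {p.1} := by
        rintro _ rfl
        exact (hB p hp).2
      have h := hT.dist_le hfix (mem_singleton p.1) (x := x) (r := p.2)
        (singleton_subset_iff.2 (Metric.mem_closedBall_comm.1 (mem_iInter₂.1 hx.2 p hp)))
      rwa [show T p.1 = p.1 from (hB p hp).2] at h⟩)
  exact ⟨x, hx.2, hx.1, hTx⟩

/-! ### Chains of one-local retracts -/

/-- Baillon's theorem: a chain of nonempty one-local retracts has a nonempty intersection, which is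
again a one-local retract. -/
theorem sInter_of_isChain_isOneLocalRetract (hc : BallCompact α) (hn : BallNormal α)
    {𝒩 : Set (Set α)} (h𝒩 : 𝒩.Nonempty) (hch : IsChain (· ⊆ ·) 𝒩)
    (hne : ∀ N ∈ 𝒩, N.Nonempty) (hret : ∀ N ∈ 𝒩, IsOneLocalRetract N) :
    (⋂₀ 𝒩).Nonempty ∧ IsOneLocalRetract (⋂₀ 𝒩) := by
  classical
  suffices H : ∀ B : Set (α × ℝ), (∀ p ∈ B, p.1 ∈ ⋂₀ 𝒩) →
      (⋂ p ∈ B, Metric.closedBall p.1 p.2).Nonempty →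
      ((⋂ p ∈ B, Metric.closedBall p.1 p.2) ∩ ⋂₀ 𝒩).Nonempty by
    refine ⟨?_, H⟩
    obtain ⟨N, hN⟩ := h𝒩
    obtain ⟨x, hx⟩ := hne N hN
    exact (H ∅ (by simp) ⟨x, by simp⟩).mono inter_subset_right
  intro B hB hBne
  -- Monotone selections of nonempty admissible sets, one in each member of the chain.
  let 𝒮 : Set (𝒩 → Set α) := {D | (∀ N : 𝒩, (D N).Nonempty ∧ IsAdmissibleIn N.1 (D N)) ∧
    ∀ N N' : 𝒩, N.1 ⊆ N'.1 → D N ⊆ D N'}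
  let D₀ : 𝒩 → Set α := fun N => N.1 ∩ ⋂ p ∈ B, Metric.closedBall p.1 p.2
  have hD₀ : D₀ ∈ 𝒮 := by
    refine ⟨fun N => ⟨?_, isAdmissibleIn_inter_biInter fun p hp => hB p hp N.1 N.2⟩,
      fun N N' h => inter_subset_inter_left _ h⟩
    exact (hret N.1 N.2 B (fun p hp => hB p hp N.1 N.2) hBne).mono fun x hx => ⟨hx.2, hx.1⟩
  obtain ⟨D, hDD₀, hD⟩ : ∃ D, D ≤ D₀ ∧ Minimal (· ∈ 𝒮) D := by
    refine zorn_le_nonempty₀ (α := (𝒩 → Set α)ᵒᵈ) 𝒮 (fun c hcS hcc D₁ hD₁ => ?_) D₀ hD₀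
    have hcne : ∀ N : 𝒩, ((fun D : 𝒩 → Set α => D N) '' c).Nonempty := fun N =>
      ⟨D₁ N, D₁, hD₁, rfl⟩
    refine ⟨fun N => ⋂₀ ((fun D : 𝒩 → Set α => D N) '' c), ⟨fun N => ⟨?_, ?_⟩, ?_⟩, ?_⟩
    · refine sInter_nonempty_of_isChain hc (hret N.1 N.2) (hcne N) ?_ ?_
      · rintro _ ⟨D, hD, rfl⟩ _ ⟨D', hD', rfl⟩ -
        rcases hcc.total hD hD' with h | h
        exacts [Or.inr (h N), Or.inl (h N)]
      · rintro _ ⟨D, hD, rfl⟩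
        exact (hcS hD).1 N
    · refine IsAdmissibleIn.sInter (hcne N) ?_
      rintro _ ⟨D, hD, rfl⟩
      exact ((hcS hD).1 N).2
    · rintro N N' h x hx _ ⟨D, hD, rfl⟩
      exact (hcS hD).2 N N' h (hx _ ⟨D, hD, rfl⟩)
    · intro D hD N x hx
      exact hx _ ⟨D, hD, rfl⟩
  obtain ⟨hDadm, hDmono⟩ := hD.prop
  -- A ball centred in `P` that contains `D P` contains `D Q` for all larger `Q`.
  have hstep : ∀ P Q : 𝒩, P.1 ⊆ Q.1 → ∀ x ∈ P.1, ∀ r,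
      D P ⊆ Metric.closedBall x r → D Q ⊆ Metric.closedBall x r := by
    intro P Q hPQ x hx r hr
    let E : 𝒩 → Set α := fun Q => if P.1 ⊆ Q.1 then D Q ∩ Metric.closedBall x r else D Q
    have hED : E ≤ D := by
      intro R
      by_cases h : P.1 ⊆ R.1
      · simp only [E, if_pos h]
        exact inter_subset_left
      · simp only [E, if_neg h]
        exact le_rfl
    have hE : E ∈ 𝒮 := by
      refine ⟨fun R => ?_, fun R R' hRR => ?_⟩
      · by_cases h : P.1 ⊆ R.1
        · simp only [E, if_pos h]
          exact ⟨(hDadm P).1.mono (subset_inter (hDmono P R h) hr),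
            (hDadm R).2.inter_closedBall (h hx) r⟩
        · simp only [E, if_neg h]
          exact hDadm R
      · by_cases h' : P.1 ⊆ R'.1
        · have hsub : E R ⊆ Metric.closedBall x r := by
            by_cases h : P.1 ⊆ R.1
            · simp only [E, if_pos h]
              exact inter_subset_right
            · simp only [E, if_neg h]
              exact (hDmono R P ((hch.total P.2 R.2).resolve_left h)).trans hr
          have : E R' = D R' ∩ Metric.closedBall x r := if_pos h'
          rw [this]
          exact subset_inter ((hED R).trans (hDmono R R' hRR)) hsub
        · have : E R' = D R' := if_neg h'
          rw [this]
          exact (hED R).trans (hDmono R R' hRR)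
    have h := hD.le_of_le hE hED Q
    simp only [E, if_pos hPQ] at h
    exact fun y hy => (h hy).2
  have hsub : ∀ N : 𝒩, (D N).Subsingleton := by
    intro N₀
    by_contra hnt
    obtain ⟨z, hz, r, hr, a, ha, b, hb, hab⟩ :=
      (hDadm N₀).2.exists_normal_point hn (hret _ N₀.2) (not_subsingleton_iff.1 hnt)
    -- One radius `r` serves all members of the chain.
    have hS : (fun N => {x ∈ D N | D N ⊆ Metric.closedBall x r}) ∈ 𝒮 := by
      refine ⟨fun N => ⟨?_, (hDadm N).2.centers r⟩, fun N N' h x hx =>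
        ⟨hDmono N N' h hx.1, hstep N N' h x ((hDadm N).2.1 hx.1) r hx.2⟩⟩
      rcases hch.total N₀.2 N.2 with h | h
      · exact ⟨z, hDmono N₀ N h hz, hstep N₀ N h z ((hDadm N₀).2.1 hz) r hr⟩
      · exact (hDadm N).2.exists_center (hret _ N.2)
          (fun x hx s hs => hstep N N₀ h x hx s hs hz) ((hDmono N N₀ h).trans hr)
    have h := hD.le_of_le hS (fun N => sep_subset _ _) N₀
    exact absurd ((h hb).2 ha) (not_le.2 hab)
  obtain ⟨N₀, hN₀⟩ := h𝒩
  obtain ⟨x, hx⟩ := (hDadm ⟨N₀, hN₀⟩).1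
  refine ⟨x, (hDD₀ _ hx).2, fun N hN => ?_⟩
  rcases hch.total hN hN₀ with h | h
  · obtain ⟨y, hy⟩ := (hDadm ⟨N, hN⟩).1
    rw [hsub ⟨N₀, hN₀⟩ hx (hDmono ⟨N, hN⟩ ⟨N₀, hN₀⟩ h hy)]
    exact (hDadm ⟨N, hN⟩).2.1 hy
  · exact h ((hDadm ⟨N₀, hN₀⟩).2.1 hx)

/-! ### Common fixed points -/

theorem isOneLocalRetract_univ : IsOneLocalRetract (univ : Set α) := fun _ _ h => by
  rwa [inter_univ]

theorem exists_common_fixedPoint_of_commute [Nonempty α] (hc : BallCompact α) (hn : BallNormal α)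
    {ι : Type*} {T : ι → α → α} (hT : ∀ i, OrbitNonexpansive (T i))
    (hcomm : ∀ i j, Function.Commute (T i) (T j)) :
    (∃ x, ∀ i, T i x = x) ∧ IsOneLocalRetract {x | ∀ i, T i x = x} := by
  let fix : Set ι → Set α := fun J => {x | ∀ i ∈ J, T i x = x}
  obtain ⟨J, hJ⟩ := zorn_subset {J : Set ι | (fix J).Nonempty ∧ IsOneLocalRetract (fix J)} (by
    intro c hcS hch
    refine ⟨⋃₀ c, ?_, fun s hs => subset_sUnion_of_mem hs⟩
    rcases c.eq_empty_or_nonempty with rfl | hcne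
    · have : fix (⋃₀ ∅) = univ := by simp [fix]
      simp only [mem_ofPred_eq, this]
      exact ⟨univ_nonempty, isOneLocalRetract_univ⟩
    · have : fix (⋃₀ c) = ⋂₀ (fix '' c) := by
        ext x
        simp only [fix, mem_sUnion, sInter_image, mem_iInter, mem_ofPred_eq]
        exact ⟨fun h J hJ i hi => h i ⟨J, hJ, hi⟩, fun h i ⟨J, hJ, hi⟩ => h J hJ i hi⟩
      simp only [mem_ofPred_eq, this]
      refine sInter_of_isChain_isOneLocalRetract hc hn (hcne.image fix) ?_ ?_ ?_
      · rintro _ ⟨J, hJ, rfl⟩ _ ⟨K, hK, rfl⟩ -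
        rcases hch.total hJ hK with h | h
        exacts [Or.inr fun x hx i hi => hx i (h hi), Or.inl fun x hx i hi => hx i (h hi)]
      · rintro _ ⟨J, hJ, rfl⟩
        exact (hcS hJ).1
      · rintro _ ⟨J, hJ, rfl⟩
        exact (hcS hJ).2)
  have hJuniv : ∀ i, i ∈ J := by
    intro i
    have hfix : fix (insert i J) = fix J ∩ {x | T i x = x} := by
      ext x
      simp [fix, and_comm]
    have h : insert i J ∈ {J : Set ι | (fix J).Nonempty ∧ IsOneLocalRetract (fix J)} := by
      simp only [mem_ofPred_eq, hfix]
      exact (hT i).fixedPoints_inter hc hn hJ.prop.1 hJ.prop.2 fun x hx j hj => by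
        rw [(hcomm j i).eq x, hx j hj]
    exact hJ.le_of_ge h (subset_insert i J) (mem_insert i J)
  have hfixJ : fix J = {x | ∀ i, T i x = x} := by
    ext x
    simp [fix, hJuniv]
  have hprop := hJ.prop
  rw [mem_ofPred_eq, hfixJ] at hprop
  exact hprop

theorem exists_common_fixedPoint_of_mulAction [Nonempty α] (hc : BallCompact α)
    (hn : BallNormal α) {S : Type*} [Group S] [MulAction S α]
    (hS : ∀ s : S, OrbitNonexpansive (fun x : α => s • x)) : ∃ x : α, ∀ s : S, s • x = x := by
  obtain ⟨x, -, hx⟩ := exists_forall_eq_of_minimal hc hn isOneLocalRetract_univ hS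
    (fun E hE s c _ r hm y hy => by
      -- an invariant set is mapped onto itself by each group element
      simpa using hm (hE.prop.2.2 s⁻¹ hy))
    univ_nonempty (.self univ) (fun s => mapsTo_univ _ _)
  exact ⟨x, hx⟩

end Admissible

/-! ### Normal structure for convergence in measure -/

/-- A topology `τ` on a normed space splits distances if, as `u` tends to `x` for `τ`, the distance
from `u` to any `y` is asymptotically at least `dist u x + dist x y`. -/
def SplitsDist (X : Type*) [NormedAddCommGroup X] (τ : TopologicalSpace X) : Prop :=
  ∀ x y : X, ∀ η > 0, {u | dist u x + dist x y ≤ dist u y + η} ∈ @nhds X τ x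

theorem SplitsDist.isClosed_closedBall {X : Type*} [NormedAddCommGroup X] {τ : TopologicalSpace X}
    (h : SplitsDist X τ) (c : X) (r : ℝ) : @IsClosed X τ (Metric.closedBall c r) := by
  refine (@isOpen_compl_iff X _ τ).1 ((isOpen_iff_mem_nhds (X := X)).2 fun x hx => ?_)
  have hx' : r < dist x c := by simpa using hx
  filter_upwards [h x c ((dist x c - r) / 2) (by linarith)] with u hu
  simp only [mem_compl_iff, Metric.mem_closedBall, not_le]
  linarith [dist_nonneg (x := u) (y := x)]

/-- If all points of `K` were diametral, `τ` would be finer than the norm topology on `K`, so that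
`K` would be totally bounded; but then the average of a finite net of `K` is not diametral. -/
theorem SplitsDist.hasNormalStructure {X : Type*} [NormedAddCommGroup X] [NormedSpace ℝ X]
    {τ : TopologicalSpace X} (h : SplitsDist X τ) : HasNormalStructure X τ := by
  intro K hconv hbdd hcomp hnt
  by_contra! hcon
  set d := Metric.diam K
  have hd0 : 0 < d := Metric.diam_pos hnt hbdd
  have hle : ∀ x ∈ K, ∀ y ∈ K, dist x y ≤ d := fun x hx y hy =>
    Metric.dist_le_diam_of_mem hbdd hx hy
  have hfar : ∀ z ∈ K, ∀ c < d, ∃ y ∈ K, c < dist z y := by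
    intro z hz c hc
    by_contra! hall
    have h₁ : outerRadius z K ≤ ENNReal.ofReal c := iSup₂_le fun y hy => by
      rw [edist_dist]
      exact ENNReal.ofReal_le_ofReal (hall y hy)
    have h₂ : d ≤ c := ENNReal.toReal_le_of_le_ofReal (dist_nonneg.trans (hall z hz))
      ((hcon z hz).trans h₁)
    linarith
  obtain ⟨t, htK, hKt⟩ := @IsCompact.elim_nhdsWithin_subcover X τ K hcomp
    (fun x => {u | dist u x < d / 2}) (fun x hx => by
      obtain ⟨y, hy, hxy⟩ := hfar x hx (d - d / 8) (by linarith)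
      rw [mem_nhdsWithin_iff_eventually]
      filter_upwards [h x y (d / 8) (by linarith)] with u hu huK
      linarith [hle u huK y hy])
  have htne : t.Nonempty := by
    obtain ⟨x, hx⟩ := hnt.nonempty
    obtain ⟨i, hi, -⟩ := mem_iUnion₂.1 (hKt hx)
    exact ⟨i, hi⟩
  have hn : (0 : ℝ) < t.card := by exact_mod_cast htne.card_pos
  have hsum : ∑ _i ∈ t, (t.card : ℝ)⁻¹ = 1 := by
    rw [Finset.sum_const, nsmul_eq_mul, mul_inv_cancel₀ hn.ne']
  have hzK : ∑ x ∈ t, (t.card : ℝ)⁻¹ • x ∈ K :=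
    hconv.sum_mem (fun _ _ => (inv_pos.2 hn).le) hsum htK
  obtain ⟨y, hy, hzy⟩ := hfar _ hzK (d - (t.card : ℝ)⁻¹ * (d / 2))
    (by have := mul_pos (inv_pos.2 hn) (half_pos hd0); linarith)
  have hjensen := (convexOn_univ_dist (E := X) y).map_sum_le (t := t)
    (w := fun _ => (t.card : ℝ)⁻¹) (p := fun x => x) (fun _ _ => (inv_pos.2 hn).le) hsum
    (fun _ _ => mem_univ _)
  obtain ⟨x₀, hx₀, hyx₀⟩ := mem_iUnion₂.1 (hKt hy)
  rw [mem_ofPred_eq, dist_comm] at hyx₀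
  have hlt : ∑ x ∈ t, dist x y ≤ t.card * d - d / 2 := by
    classical
    rw [← Finset.add_sum_erase t _ hx₀]
    have := Finset.sum_le_card_nsmul (t.erase x₀) (fun x => dist x y) d
      fun x hx => hle x (htK x (Finset.mem_of_mem_erase hx)) y hy
    rw [Finset.card_erase_of_mem hx₀, nsmul_eq_mul, Nat.cast_sub htne.card_pos] at this
    push_cast at this
    linarith
  simp only [smul_eq_mul] at hjensen
  rw [← Finset.mul_sum] at hjensen
  have h₁ := mul_le_mul_of_nonneg_left hlt (inv_pos.2 hn).le
  rw [mul_sub, ← mul_assoc, inv_mul_cancel₀ hn.ne', one_mul] at h₁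
  linarith

/-- The Brezis–Lieb inequality for convergence in measure: outside a set `E` of small measure `u` is
uniformly close to `x`, and on `E` the function `x - y` has small integral. -/
theorem exists_measureEntourage_edist_add_le {𝕜 : Type*} [RCLike 𝕜] (x y : L1Unit 𝕜) {η : ℝ≥0∞}
    (hη : 0 < η) : ∃ δ > 0, ∀ u, (x, u) ∈ measureEntourage 𝕜 δ →
      edist u x + edist x y ≤ edist u y + η := by
  have hη4 : 0 < η / 4 := ENNReal.div_pos hη.ne' (by simp)
  have hfin : ∫⁻ t in Icc (0 : ℝ) 1, edist (x t) (y t) ≠ ∞ := by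
    rw [← L1.edist_def]
    exact edist_ne_top x y
  obtain ⟨δ₀, hδ₀, hsmall⟩ := exists_pos_setLIntegral_lt_of_measure_lt hfin hη4.ne'
  obtain ⟨δ, hδ, hδlt⟩ := exists_between (lt_min hδ₀ hη4)
  refine ⟨δ, hδ, fun u hu => ?_⟩
  set E : Set ℝ := {t | δ ≤ edist (x t) (u t)}
  have hEsmall := (hsmall E (lt_of_le_of_lt hu (hδlt.trans_le (min_le_left _ _)))).le
  have hpt : ∀ t, edist (u t) (x t) + edist (x t) (y t) ≤
      edist (u t) (y t) + (2 * δ + E.indicator (fun t => 2 * edist (x t) (y t)) t) := by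
    intro t
    by_cases ht : t ∈ E
    · rw [indicator_of_mem ht]
      calc edist (u t) (x t) + edist (x t) (y t)
          ≤ edist (u t) (y t) + edist (y t) (x t) + edist (x t) (y t) := by
            gcongr; exact edist_triangle _ _ _
        _ = edist (u t) (y t) + 2 * edist (x t) (y t) := by
            rw [edist_comm (y t) (x t), two_mul, add_assoc]
        _ ≤ _ := by gcongr; exact le_add_self
    · rw [indicator_of_notMem ht, add_zero]
      have ht' : edist (x t) (u t) ≤ δ := (not_le.1 ht).le
      calc edist (u t) (x t) + edist (x t) (y t)
          ≤ edist (u t) (x t) + (edist (x t) (u t) + edist (u t) (y t)) := by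
            gcongr; exact edist_triangle _ _ _
        _ ≤ δ + (δ + edist (u t) (y t)) := by
            gcongr; rwa [edist_comm]
        _ = edist (u t) (y t) + 2 * δ := by ring
  have hux : AEMeasurable (fun t => edist (u t) (x t)) (volume.restrict (Icc (0 : ℝ) 1)) :=
    (Lp.aestronglyMeasurable u).edist (Lp.aestronglyMeasurable x)
  have huy : AEMeasurable (fun t => edist (u t) (y t)) (volume.restrict (Icc (0 : ℝ) 1)) :=
    (Lp.aestronglyMeasurable u).edist (Lp.aestronglyMeasurable y)
  have hint := lintegral_mono (μ := volume.restrict (Icc (0 : ℝ) 1)) hpt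
  rw [lintegral_add_left' hux, lintegral_add_left' huy, lintegral_add_left measurable_const,
    ← L1.edist_def, ← L1.edist_def, ← L1.edist_def, lintegral_const] at hint
  refine hint.trans (add_le_add_right ?_ _)
  have hI : ∫⁻ t in Icc (0 : ℝ) 1, E.indicator (fun t => 2 * edist (x t) (y t)) t ≤ 2 * (η / 4) :=
    (lintegral_indicator_le _ _).trans (by
      rw [lintegral_const_mul' _ _ (by simp)]
      gcongr)
  calc 2 * δ * volume.restrict (Icc (0 : ℝ) 1) univ
        + ∫⁻ t in Icc (0 : ℝ) 1, E.indicator (fun t => 2 * edist (x t) (y t)) t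
      ≤ 2 * (η / 4) + 2 * (η / 4) := by
        refine add_le_add ?_ hI
        simp only [Measure.restrict_apply_univ, Real.volume_Icc, sub_zero, ENNReal.ofReal_one,
          mul_one]
        gcongr
        exact (hδlt.trans_le (min_le_right _ _)).le
    _ = 4 * (η / 4) := by ring
    _ = η := ENNReal.mul_div_cancel (by simp) (by simp)

theorem measureEntourage_preimage_mem_nhds {𝕜 : Type*} [RCLike 𝕜] (x : L1Unit 𝕜) {δ : ℝ≥0∞}
    (hδ : 0 < δ) :
    {u | (x, u) ∈ measureEntourage 𝕜 δ} ∈ @nhds _ (measureUniformity 𝕜).toTopologicalSpace x :=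
  @mem_nhds_left _ (measureUniformity 𝕜) x _
    (mem_iInf_of_mem δ (mem_iInf_of_mem hδ (mem_principal_self _)))

theorem splitsDist_inMeasureTopology {𝕜 X : Type*} [RCLike 𝕜] [NormedAddCommGroup X]
    [NormedSpace 𝕜 X] (e : X ≃ₗᵢ[𝕜] L1Unit 𝕜) : SplitsDist X (inMeasureTopology e) := by
  intro x y η hη
  obtain ⟨δ, hδ, h⟩ := exists_measureEntourage_edist_add_le (e x) (e y) (ENNReal.ofReal_pos.2 hη)
  rw [@nhds_induced _ _ (measureUniformity 𝕜).toTopologicalSpace]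
  refine ⟨_, measureEntourage_preimage_mem_nhds (e x) hδ, fun u hu => ?_⟩
  have h' := h (e u) hu
  simp only [e.isometry.edist_eq, edist_dist] at h'
  rwa [← ENNReal.ofReal_add dist_nonneg dist_nonneg, ← ENNReal.ofReal_add dist_nonneg hη.le,
    ENNReal.ofReal_le_ofReal_iff (by positivity)] at h'

/-! ### Closed balls in the weak topologies -/

theorem isClosed_closedBall_weakTopology (𝕜 : Type*) {X : Type*} [RCLike 𝕜] [NormedAddCommGroup X]
    [NormedSpace 𝕜 X] (c : X) (r : ℝ) :
    @IsClosed X (weakTopology 𝕜 X) (Metric.closedBall c r) := by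
  rcases lt_or_ge r 0 with hr | hr
  · rw [Metric.closedBall_eq_empty.2 hr]
    exact @isClosed_empty X (weakTopology 𝕜 X)
  have hclosed : IsClosed (⋂ f : StrongDual 𝕜 X,
      {w : WeakSpace 𝕜 X | ‖f ((toWeakSpace 𝕜 X).symm w) - f c‖ ≤ r * ‖f‖}) := by
    refine isClosed_iInter fun f => isClosed_le (Continuous.norm (Continuous.sub ?_
      continuous_const)) continuous_const
    exact WeakBilin.eval_continuous (topDualPairing 𝕜 X).flip f
  refine (@isClosed_induced_iff _ _ _ _ _).2 ⟨_, hclosed, ?_⟩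
  ext x
  simp only [mem_preimage, mem_iInter, mem_ofPred_eq, LinearEquiv.symm_apply_apply,
    mem_closedBall_iff_norm, ← map_sub]
  refine ⟨fun h => NormedSpace.norm_le_dual_bound 𝕜 (x - c) hr h, fun h f => ?_⟩
  rw [mul_comm]
  exact f.le_opNorm_of_le h

theorem isClosed_closedBall_weakStarTopology {𝕜 X Y : Type*} [RCLike 𝕜] [NormedAddCommGroup X]
    [NormedSpace 𝕜 X] [NormedAddCommGroup Y] [NormedSpace 𝕜 Y] (e : X ≃ₗᵢ[𝕜] StrongDual 𝕜 Y)
    (c : X) (r : ℝ) : @IsClosed X (weakStarTopology e) (Metric.closedBall c r) := by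
  refine (@isClosed_induced_iff _ _ _ _ _).2
    ⟨_, WeakDual.isClosed_closedBall (e c) r, ?_⟩
  ext x
  have h : dist (e x) (e c) = dist x c := e.isometry.dist_eq x c
  rw [Metric.mem_closedBall, ← h]
  rfl

/-! ### From the topology to the metric -/

theorem ballCompact_of_isCompact {X : Type*} [NormedAddCommGroup X] {τ : TopologicalSpace X}
    (hball : ∀ (c : X) (r : ℝ), @IsClosed X τ (Metric.closedBall c r)) {M : Set X}
    (hM : @IsCompact X τ M) : BallCompact M := by
  classical
  intro B hB
  obtain ⟨x, hxM, hx⟩ := @IsCompact.inter_iInter_nonempty X τ M B hM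
    (fun p => Metric.closedBall (p.1.1 : X) p.1.2) (fun p => hball _ _) (fun F => by
      obtain ⟨w, hw⟩ := hB (F.image Subtype.val) (by simp)
      rw [mem_iInter₂] at hw
      exact ⟨w, w.2, mem_iInter₂.2 fun p hp => hw p.1 (Finset.mem_image_of_mem _ hp)⟩)
  rw [mem_iInter] at hx
  exact ⟨⟨x, hxM⟩, mem_iInter₂.2 fun p hp => hx ⟨p, hp⟩⟩

theorem ballNormal_of_hasNormalStructure {X : Type*} [NormedAddCommGroup X] [NormedSpace ℝ X]
    {τ : TopologicalSpace X} (hball : ∀ (c : X) (r : ℝ), @IsClosed X τ (Metric.closedBall c r))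
    (hτ : HasNormalStructure X τ) {M : Set X} (hconv : Convex ℝ M) (hbdd : Bornology.IsBounded M)
    (hM : @IsCompact X τ M) : BallNormal M := by
  intro B hnt
  let K : Set X := M ∩ ⋂ p ∈ B, Metric.closedBall (p.1 : X) p.2
  have hmem : ∀ w : M, w ∈ (⋂ p ∈ B, Metric.closedBall p.1 p.2) ↔ (w : X) ∈ K := fun w => by
    simp [K, Subtype.dist_eq]
  have hK₁ : Convex ℝ K := hconv.inter (convex_iInter₂ fun p _ => convex_closedBall _ _)
  have hK₂ : @IsCompact X τ K := @IsCompact.inter_right X τ _ _ hM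
    (@isClosed_biInter X _ τ _ _ fun p _ => hball _ _)
  have hK₃ : K.Nontrivial := by
    obtain ⟨a, ha, b, hb, hab⟩ := hnt
    exact ⟨a, (hmem a).1 ha, b, (hmem b).1 hb, Subtype.coe_ne_coe.2 hab⟩
  obtain ⟨z, hz, hlt⟩ := hτ K hK₁ (hbdd.subset inter_subset_left) hK₂ hK₃
  have htop : outerRadius z K ≠ ∞ := hlt.ne_top
  have hpair : ∃ a ∈ K, ∃ b ∈ K, outerRadius z K < edist a b := by
    by_contra! hcon
    exact absurd hlt (not_lt.2 (Metric.ediam_le hcon))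
  obtain ⟨a, ha, b, hb, hab⟩ := hpair
  refine ⟨⟨z, hz.1⟩, (hmem _).2 hz, (outerRadius z K).toReal, fun w hw => ?_,
    ⟨a, ha.1⟩, (hmem _).2 ha, ⟨b, hb.1⟩, (hmem _).2 hb, ?_⟩
  · rw [Metric.mem_closedBall', Subtype.dist_eq, dist_edist]
    exact ENNReal.toReal_mono htop (le_iSup₂ (f := fun a _ => edist z a) w.1 ((hmem w).1 hw))
  · rw [Subtype.dist_eq, dist_edist]
    exact (ENNReal.toReal_lt_toReal htop (edist_ne_top a b)).2 hab

theorem corollary3p7 {𝕜 : Type*} [RCLike 𝕜] {X : Type*} [NormedAddCommGroup X]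
    [NormedSpace 𝕜 X] [NormedSpace ℝ X] [IsScalarTower ℝ 𝕜 X] [CompleteSpace X]
    (M : Set X) (hne : M.Nonempty) (hconv : Convex ℝ M) (hclosed : IsClosed M)
    (hbdd : Bornology.IsBounded M)
    (hM :
      -- (i) the weak topology
      (HasNormalStructure X (weakTopology 𝕜 X) ∧ @IsCompact X (weakTopology 𝕜 X) M) ∨
      -- (ii) the weak* topology of a dual space
      (∃ (Y : Type*) (_ : NormedAddCommGroup Y) (_ : NormedSpace 𝕜 Y)
        (e : X ≃ₗᵢ[𝕜] StrongDual 𝕜 Y),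
        HasNormalStructure X (weakStarTopology e) ∧ @IsCompact X (weakStarTopology e) M) ∨
      -- (iii) convergence in measure on the space of integrable functions on the unit interval
      (∃ e : X ≃ₗᵢ[𝕜] L1Unit 𝕜, @IsCompact X (inMeasureTopology e) M)) :
    (∀ (ι : Type*) (T : ι → M → M), (∀ i, OrbitNonexpansive (T i)) →
      (∀ i j, Function.Commute (T i) (T j)) →
      (∃ x : M, ∀ i, T i x = x) ∧ IsOneLocalRetract {x : M | ∀ i, T i x = x}) ∧
    (∀ (S : Type*) [Group S] [MulAction S M],
      (∀ s : S, OrbitNonexpansive (fun x : M => s • x)) →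
      ∃ x : M, ∀ s : S, s • x = x) := by
  obtain ⟨τ, hball, hτ, hMτ⟩ : ∃ τ : TopologicalSpace X,
      (∀ (c : X) (r : ℝ), @IsClosed X τ (Metric.closedBall c r)) ∧ HasNormalStructure X τ ∧
        @IsCompact X τ M := by
    rcases hM with ⟨hτ, hMτ⟩ | ⟨Y, _, _, e, hτ, hMτ⟩ | ⟨e, hMτ⟩
    · exact ⟨_, isClosed_closedBall_weakTopology 𝕜, hτ, hMτ⟩
    · exact ⟨_, isClosed_closedBall_weakStarTopology e, hτ, hMτ⟩
    · have hsplit := splitsDist_inMeasureTopology e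
      exact ⟨_, hsplit.isClosed_closedBall, hsplit.hasNormalStructure, hMτ⟩
  have hc : BallCompact M := ballCompact_of_isCompact hball hMτ
  have hn : BallNormal M := ballNormal_of_hasNormalStructure hball hτ hconv hbdd hMτ
  have : Nonempty M := hne.to_subtype
  exact ⟨fun ι T hT hcomm => exists_common_fixedPoint_of_commute hc hn hT hcomm,
    fun S _ _ hS => exists_common_fixedPoint_of_mulAction hc hn hS⟩
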